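/- Let $B_3=\langle \sigma_1,\sigma_2 \mid \sigma_1\sigma_2\sigma_1=\sigma_2\sigma_1\sigma_2\rangle$ be the braid group on three strands, and let $b_{-1}\colon B_3\to \mathrm{GL}_3(\mathbb Z)$ be the integral Burau representation (the Burau representation at $t=-1$), $$\sigma_1\mapsto\begin{pmatrix}2&-1&0\\1&0&0\\0&0&1\end{pmatrix},\qquad \sigma_2\mapsto\begin{pmatrix}1&0&0\\0&2&-1\\0&1&0\end{pmatrix}.$$ Let $\rho\colon B_3\to \mathrm{Sp}_2(\mathbb Z)=\mathrm{SL}_2(\mathbb Z)$ be its restriction to the invariant sublattice $\{(x,y,z)\in\mathbb Z^3 : x-y+z=0\}$, written in the basis $(1,1,0),(0,1,1)$, so that $$\rho(\sigma_1)=\begin{pmatrix}1&-1\\0&1\end{pmatrix},\qquad \rho(\sigma_2)=\begin{pmatrix}1&0\\1&1\end{pmatrix}.$$ For $m\ge 1$, the level $m$ congruence subgroup $B_3[m]$ is the kernel of the composition $\rho_m$ of $\rho$ with the reduction $\mathrm{SL}_2(\mathbb Z)\to\mathrm{SL}_2(\mathbb Z/m\mathbb Z)$. **Theorem.** Let $p\ge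 3$ be a prime. Then $M=1+\frac{(p-1)p(p+1)}{12}$ is a natural number, and there is an isomorphism $$B_3[p]\;\cong\;\mathbb Z\times F_M,$$ where $F_M$ is the free group of rank $M$, under which the generator $1$ of the factor $\mathbb Z$ corresponds to $(\sigma_1\sigma_2)^6$ (in particular $(\sigma_1\sigma_2)^6\in B_3[p]$). -/

import Mathlib

open scoped MatrixGroups

/-- Artin's relators for the braid group on `n` strands; the generator `i : Fin (n - 1)` is the
half-twist usually written `σ_{i+1}`. -/
inductive BraidRelator (n : ℕ) : FreeGroup (Fin (n - 1)) → Prop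
  | comm (i j : Fin (n - 1)) (h : i.val + 1 < j.val ∨ j.val + 1 < i.val) :
      BraidRelator n (FreeGroup.of i * FreeGroup.of j *
        (FreeGroup.of j * FreeGroup.of i)⁻¹)
  | braid (i j : Fin (n - 1)) (h : i.val + 1 = j.val ∨ j.val + 1 = i.val) :
      BraidRelator n (FreeGroup.of i * FreeGroup.of j * FreeGroup.of i *
        (FreeGroup.of j * FreeGroup.of i * FreeGroup.of j)⁻¹)

/-- The braid group `B_n`, through Artin's presentation. -/
abbrev BraidGroup (n : ℕ) : Type := PresentedGroup {r | BraidRelator n r}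

namespace BraidGroup

/-- The Artin generator `σ_{i+1}` of `B_n`. -/
def sigma {n : ℕ} (i : Fin (n - 1)) : BraidGroup n := PresentedGroup.of i

/-- The generator `σ₁` of `B_3`. -/
def sigma1 : BraidGroup 3 := sigma (n := 3) 0

/-- The generator `σ₂` of `B_3`. -/
def sigma2 : BraidGroup 3 := sigma (n := 3) 1

/-- Two elements `a`, `b` of a group with `a b a = b a b` define a homomorphism `B_3 →* G` with
`σ₁ ↦ a` and `σ₂ ↦ b`. -/
def lift3 {G : Type*} [Group G] (a b : G) (h : a * b * a = b * a * b) : BraidGroup 3 →* G :=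
  PresentedGroup.toGroup (f := (![a, b] : Fin 2 → G)) (by
    rintro r (⟨i, j, hij⟩ | ⟨i, j, hij⟩)
    · exfalso
      have hi := i.isLt
      have hj := j.isLt
      omega
    · change Fin 2 at i j
      rw [map_mul, map_inv, mul_inv_eq_one]
      fin_cases i <;> fin_cases j <;> simp_all)

theorem lift3_sigma1 {G : Type*} [Group G] (a b : G) (h : a * b * a = b * a * b) :
    lift3 a b h sigma1 = a :=
  PresentedGroup.toGroup.of _

theorem lift3_sigma2 {G : Type*} [Group G] (a b : G) (h : a * b * a = b * a * b) :
    lift3 a b h sigma2 = b :=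
  PresentedGroup.toGroup.of _

theorem induction3 {P : BraidGroup 3 → Prop} (h1 : P sigma1) (h2 : P sigma2) (hone : P 1)
    (hmul : ∀ x y, P x → P y → P (x * y)) (hinv : ∀ x, P x → P x⁻¹) (g : BraidGroup 3) : P g := by
  have hg : g ∈ Subgroup.closure
      (Set.range (PresentedGroup.of : Fin (3 - 1) → BraidGroup 3)) := by
    rw [PresentedGroup.closure_range_of]
    trivial
  induction hg using Subgroup.closure_induction with
  | mem x hx =>
    obtain ⟨i, rfl⟩ := hx
    change Fin 2 at i
    fin_cases i
    · exact h1
    · exact h2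
  | one => exact hone
  | mul x y _ _ hx hy => exact hmul x y hx hy
  | inv x _ hx => exact hinv x hx

/-- The Burau matrix `[[1 - t, t], [1, 0]] ⊕ I_1` of `σ₁`. -/
def burauSigma1 {R : Type*} [CommRing R] (t : Rˣ) : GL (Fin 3) R where
  val := !![1 - (t : R), (t : R), 0; 1, 0, 0; 0, 0, 1]
  inv := !![0, 1, 0; ((t⁻¹ : Rˣ) : R), 1 - ((t⁻¹ : Rˣ) : R), 0; 0, 0, 1]
  val_inv := by
    ext i j
    fin_cases i <;> fin_cases j <;> simp [Matrix.mul_apply, Fin.sum_univ_three, mul_sub]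
  inv_val := by
    ext i j
    fin_cases i <;> fin_cases j <;> simp [Matrix.mul_apply, Fin.sum_univ_three, mul_sub]

/-- The Burau matrix `I_1 ⊕ [[1 - t, t], [1, 0]]` of `σ₂`. -/
def burauSigma2 {R : Type*} [CommRing R] (t : Rˣ) : GL (Fin 3) R where
  val := !![1, 0, 0; 0, 1 - (t : R), (t : R); 0, 1, 0]
  inv := !![1, 0, 0; 0, 0, 1; 0, ((t⁻¹ : Rˣ) : R), 1 - ((t⁻¹ : Rˣ) : R)]
  val_inv := by
    ext i j
    fin_cases i <;> fin_cases j <;> simp [Matrix.mul_apply, Fin.sum_univ_three, mul_sub]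
  inv_val := by
    ext i j
    fin_cases i <;> fin_cases j <;> simp [Matrix.mul_apply, Fin.sum_univ_three, mul_sub]

/-- The (reducible) Burau representation `b_t : B_3 → GL_3(R)` at a unit `t` of a commutative ring
`R`; the generic one is the case `R = ℤ[t, t⁻¹]`. -/
def burau {R : Type*} [CommRing R] (t : Rˣ) : BraidGroup 3 →* GL (Fin 3) R :=
  lift3 (burauSigma1 t) (burauSigma2 t) (by
    apply Units.ext
    ext i j
    fin_cases i <;> fin_cases j <;>
      simp [burauSigma1, burauSigma2, Matrix.mul_apply, Fin.sum_univ_three] <;> ring)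

/-- The integral Burau representation `b_{-1} : B_3 → GL_3(ℤ)`. -/
def integralBurau : BraidGroup 3 →* GL (Fin 3) ℤ := burau (-1)

/-- The matrix of `ρ(σ₁)`. -/
def rhoSigma1 : SL(2, ℤ) := ⟨!![1, -1; 0, 1], by decide⟩

/-- The matrix of `ρ(σ₂)`. -/
def rhoSigma2 : SL(2, ℤ) := ⟨!![1, 0; 1, 1], by decide⟩

/-- The symplectic representation `ρ : B_3 → Sp_2(ℤ) = SL_2(ℤ)`. It is the restriction of the
integral Burau representation to its invariant sublattice `{(x, y, z) | x - y + z = 0}` of `ℤ³`,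
written in the basis `(1, 1, 0)`, `(0, 1, 1)` of that lattice: see `integralBurau_mul_basis`. -/
def rho : BraidGroup 3 →* SL(2, ℤ) :=
  lift3 rhoSigma1 rhoSigma2 (by decide)

/-- The reduction `ρ_m : B_3 → Sp_2(ℤ/m) = SL_2(ℤ/m)` of the symplectic representation. -/
def rhoMod (m : ℕ) : BraidGroup 3 →* SL(2, ZMod m) :=
  (Matrix.SpecialLinearGroup.map (Int.castRingHom (ZMod m))).comp rho

/-- The level `m` congruence subgroup `B_3[m]`, the kernel of `ρ_m`. -/
def congruenceSubgroup (m : ℕ) : Subgroup (BraidGroup 3) := (rhoMod m).ker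

/-- The matrix with columns `(1, 1, 0)`, `(0, 1, 1)`. -/
def symplecticBasis : Matrix (Fin 3) (Fin 2) ℤ := !![1, 0; 1, 1; 0, 1]

/-- `ρ` is the restriction of the integral Burau representation to the lattice spanned by
`(1, 1, 0)` and `(0, 1, 1)`. -/
theorem integralBurau_mul_basis (g : BraidGroup 3) :
    (integralBurau g : Matrix (Fin 3) (Fin 3) ℤ) * symplecticBasis =
      symplecticBasis * (rho g : Matrix (Fin 2) (Fin 2) ℤ) := by
  induction g using induction3 with
  | h1 =>
    rw [integralBurau, burau, rho, lift3_sigma1, lift3_sigma1]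
    simp only [burauSigma1, rhoSigma1, symplecticBasis]
    decide
  | h2 =>
    rw [integralBurau, burau, rho, lift3_sigma2, lift3_sigma2]
    simp only [burauSigma2, rhoSigma2, symplecticBasis]
    decide
  | hone => simp
  | hmul x y hx hy =>
    rw [map_mul, map_mul, Units.val_mul, Matrix.SpecialLinearGroup.coe_mul, Matrix.mul_assoc, hy,
      ← Matrix.mul_assoc, hx, Matrix.mul_assoc]
  | hinv x hx =>
    have h1 : ((integralBurau x⁻¹ : GL (Fin 3) ℤ) : Matrix (Fin 3) (Fin 3) ℤ) *
        (integralBurau x : Matrix (Fin 3) (Fin 3) ℤ) = 1 := by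
      rw [← Units.val_mul, ← map_mul]; simp
    have h2 : (rho x : Matrix (Fin 2) (Fin 2) ℤ) * (rho x⁻¹ : Matrix (Fin 2) (Fin 2) ℤ) = 1 := by
      rw [← Matrix.SpecialLinearGroup.coe_mul, ← map_mul]; simp
    calc _ = ((integralBurau x⁻¹ : GL (Fin 3) ℤ) : Matrix (Fin 3) (Fin 3) ℤ) * (symplecticBasis *
          ((rho x : Matrix (Fin 2) (Fin 2) ℤ) * (rho x⁻¹ : Matrix (Fin 2) (Fin 2) ℤ))) := by
            rw [h2, Matrix.mul_one]
      _ = _ := by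
            rw [← Matrix.mul_assoc symplecticBasis, ← hx, Matrix.mul_assoc, ← Matrix.mul_assoc, h1,
              Matrix.one_mul]

/-- `(1, 1, 1)`, which spans a complement of that lattice in `ℤ³`, is fixed. -/
theorem integralBurau_mulVec_one (g : BraidGroup 3) :
    Matrix.mulVec (integralBurau g : Matrix (Fin 3) (Fin 3) ℤ) ![1, 1, 1] = ![1, 1, 1] := by
  induction g using induction3 with
  | h1 =>
    rw [integralBurau, burau, lift3_sigma1]
    simp only [burauSigma1]
    decide
  | h2 =>
    rw [integralBurau, burau, lift3_sigma2]
    simp only [burauSigma2]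
    decide
  | hone => simp
  | hmul x y hx hy => rw [map_mul, Units.val_mul, ← Matrix.mulVec_mulVec, hy, hx]
  | hinv x hx =>
    conv_lhs => rw [← hx]
    rw [Matrix.mulVec_mulVec, ← Units.val_mul, ← map_mul]
    simp

/-- `B_3[m]` is also the kernel of the integral Burau representation modulo `m`. -/
theorem mem_congruenceSubgroup_iff (m : ℕ) (g : BraidGroup 3) :
    g ∈ congruenceSubgroup m ↔
      (integralBurau g : Matrix (Fin 3) (Fin 3) ℤ).map (Int.cast : ℤ → ZMod m) = 1 := by
  have hA := integralBurau_mul_basis g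
  have hv := integralBurau_mulVec_one g
  have hrho : g ∈ congruenceSubgroup m ↔
      (rho g : Matrix (Fin 2) (Fin 2) ℤ).map (Int.cast : ℤ → ZMod m) = 1 := by
    rw [congruenceSubgroup, MonoidHom.mem_ker, rhoMod, MonoidHom.comp_apply]
    exact Subtype.ext_iff
  rw [hrho]
  generalize (integralBurau g : Matrix (Fin 3) (Fin 3) ℤ) = A at *
  generalize (rho g : Matrix (Fin 2) (Fin 2) ℤ) = C at *
  have e := fun i j => congrArg (fun z : ℤ => (z : ZMod m)) (congrFun (congrFun hA i) j)
  have f := fun i => congrArg (fun z : ℤ => (z : ZMod m)) (congrFun hv i)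
  simp only [Fin.forall_fin_succ, symplecticBasis, Matrix.mul_apply, Fin.sum_univ_succ,
    Matrix.mulVec, dotProduct] at e f
  simp at e f
  simp only [← Matrix.ext_iff, Fin.forall_fin_succ]
  simp
  grind

end BraidGroup

/-! ### Transversals and rooted spanning trees. -/

section Combinatorics

/-! Modulo its central full twist Δ² = (σ₁σ₂)³, the group B₃ is the free product of ℤ/2 and ℤ/3,
generated by a = Δ and b = σ₁σ₂ (`isModularPresentation_quotient_fullTwist`). As Δ² maps to -1, ρ_p
induces a surjection q from this quotient onto Q = SL₂(𝔽_p)/{±1}, with q(a) and q(b) nontrivial.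

The kernel of q is free (`IsModularPresentation.exists_ker_mulEquiv`). Take the connected graph with
dart set Q, cosets of ⟨q(b)⟩ as vertices, and left multiplication by q(a) as dart reversal. It has
|Q|/2 edges and |Q|/3 vertices, and the kernel is its fundamental group, free of rank |Q|/6 + 1 = M.
A cocycle labelling paths by their non-tree edges provides the isomorphism.

Finally B₃[p] maps onto this kernel, with kernel B₃[p] ∩ ⟨Δ²⟩. Since -1 ≠ 1 mod p, this is the
central infinite cyclic group ⟨Δ⁴⟩ = ⟨(σ₁σ₂)⁶⟩, and the extension splits because the quotient is
free. -/

/-- A fixed-point-free involution on a finite type admits, on any invariant set, a set of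
representatives of its orbits. -/
theorem Function.Involutive.exists_transversal {α : Type*} [Finite α] {i : α → α}
    (hi : Function.Involutive i) (hfix : ∀ x, i x ≠ x) (S : Set α) (hS : ∀ x ∈ S, i x ∈ S) :
    ∃ D ⊆ S, (∀ x ∈ D, i x ∉ D) ∧ ∀ x ∈ S, x ∈ D ∨ i x ∈ D := by
  obtain ⟨n, ⟨e⟩⟩ := Finite.exists_equiv_fin α
  refine ⟨{x | x ∈ S ∧ e x < e (i x)}, fun x hx => hx.1, ?_, ?_⟩
  · rintro x ⟨_, h⟩ ⟨_, h'⟩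
    rw [hi x] at h'
    exact lt_asymm h h'
  · intro x hx
    rcases lt_trichotomy (e x) (e (i x)) with h | h | h
    · exact Or.inl ⟨hx, h⟩
    · exact absurd (e.injective h).symm (hfix x)
    · exact Or.inr ⟨hS x hx, by rwa [hi x]⟩

/-- Rooted spanning trees: in a connected graph with darts `Q`, vertices `V`, source map `π` and
dart reversal `i`, each vertex `v` other than the root has a dart `t v` that leaves it towards a
vertex of smaller depth. -/
theorem exists_parent_dart {Q V : Type*} (π : Q → V) (i : Q → Q)
    (x₀ : Q) (hconn : ∀ C : Set V, π x₀ ∈ C → (∀ x, π (i x) ∈ C → π x ∈ C) → ∀ v, v ∈ C) :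
    ∃ (t : V → Q) (d : V → ℕ), t (π x₀) = x₀ ∧ (∀ v, π (t v) = v) ∧
      ∀ v, v ≠ π x₀ → d (π (i (t v))) < d v := by
  classical
  -- `B n` is the ball of radius n about the root, so `δ` below is the distance to the root.
  let B : ℕ → Set V := fun n => n.rec {π x₀} fun _ C => C ∪ {v | ∃ x, π x = v ∧ π (i x) ∈ C}
  have hB : ∀ v, ∃ n, v ∈ B n := by
    refine hconn {v | ∃ n, v ∈ B n} ⟨0, rfl⟩ ?_
    rintro x ⟨n, hn⟩
    exact ⟨n + 1, Or.inr ⟨x, rfl, hn⟩⟩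
  let δ : V → ℕ := fun v => sInf {n | v ∈ B n}
  have key : ∀ v : V, ∃ x : Q, π x = v ∧ (v ≠ π x₀ → δ (π (i x)) < δ v) := by
    intro v
    by_cases hv : v = π x₀
    · exact ⟨x₀, hv.symm, fun h => absurd hv h⟩
    have hspec : v ∈ B (δ v) := Nat.sInf_mem (hB v)
    rcases hn : δ v with _ | n
    · rw [hn] at hspec
      exact absurd hspec hv
    · rw [hn] at hspec
      rcases hspec with h | ⟨x, hx, h⟩
      · have : δ v ≤ n := Nat.sInf_le h
        omega
      · have h1 : δ (π (i x)) ≤ n := Nat.sInf_le h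
        exact ⟨x, hx, fun _ => by omega⟩
  choose t ht hd using key
  -- Choice forgets which dart was taken at the root, so `x₀` is put back there.
  refine ⟨Function.update t (π x₀) x₀, δ, by simp, fun v => ?_,
    fun v hv => ?_⟩
  · by_cases hv : v = π x₀
    · subst hv; simp
    · rw [Function.update_of_ne hv, ht]
  · rw [Function.update_of_ne hv]
    exact hd v hv

/-- Recursion along the parent map of a rooted tree. -/
theorem exists_rec_of_parent {V G : Type*} (d : V → ℕ) (v₀ : V) (par : V → V)
    (hd : ∀ v, v ≠ v₀ → d (par v) < d v) (g₀ : G) (step : V → G → G) :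
    ∃ γ : V → G, γ v₀ = g₀ ∧ ∀ v, v ≠ v₀ → γ v = step v (γ (par v)) := by
  classical
  let F : ∀ v, (∀ w, d w < d v → G) → G := fun v rec =>
    if h : v = v₀ then g₀ else step v (rec (par v) (hd v h))
  let wf : WellFounded fun v w : V => d v < d w := InvImage.wf d Nat.lt_wfRel.wf
  refine ⟨wf.fix F, ?_, fun v hv => ?_⟩
  · rw [wf.fix_eq]; simp [F]
  · rw [wf.fix_eq]; simp [F, hv]

end Combinatorics

/-! ### Free kernels of finite quotients of ℤ/2 * ℤ/3. -/

section ModularFree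

variable {G Q : Type} [Group G] [Group Q]

open Classical in
/-- The label in the free group on `D` of the dart `x`, where reversing darts is multiplication by
`a`. -/
noncomputable def dartLabel (D : Set Q) (a x : Q) : FreeGroup D :=
  if h : x ∈ D then FreeGroup.of ⟨x, h⟩
  -- The default 1 is for darts of the spanning tree, which lie neither in `D` nor in its reversal.
  else if h : a * x ∈ D then (FreeGroup.of ⟨a * x, h⟩)⁻¹ else 1

theorem dartLabel_mul_dartLabel (D : Set Q) {a : Q} (ha : a ^ 2 = 1)
    (hD : ∀ x ∈ D, a * x ∉ D) (x : Q) : dartLabel D a (a * x) * dartLabel D a x = 1 := by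
  have h2 : a * (a * x) = x := by rw [← mul_assoc, ← sq, ha, one_mul]
  unfold dartLabel
  by_cases h : x ∈ D
  · have := hD x h
    simp [h, this, h2]
  · by_cases h' : a * x ∈ D
    · simp [h, h']
    · simp [h, h', h2]

/-- A group generated by `a`, `b` subject only to `a ^ 2 = 1` and `b ^ 3 = 1`. -/
structure IsModularPresentation (a b : G) : Prop where
  sq_eq : a ^ 2 = 1
  cube_eq : b ^ 3 = 1
  closure_eq : Subgroup.closure {a, b} = ⊤
  exists_hom : ∀ (P : Type) [Group P] (A B : P), A ^ 2 = 1 → B ^ 3 = 1 →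
    ∃ f : G →* P, f a = A ∧ f b = B

/-- Let `a` and `b` act on `Q × FreeGroup D` over their action on `Q`, with `a` also multiplying by
the label of the dart and `b` changing nothing else. Opposite darts have inverse labels, so the
relations hold and all of `G` acts; `c g x` is the multiplier acquired over `x`. -/
theorem IsModularPresentation.exists_cocycle {a b : G} (hG : IsModularPresentation a b)
    (q : G →* Q) (D : Set Q) (hD : ∀ x ∈ D, q a * x ∉ D) :
    ∃ c : G → Q → FreeGroup D, (∀ x, c a x = dartLabel D (q a) x) ∧ (∀ x, c b x = 1) ∧
      ∀ g h x, c (g * h) x = c g (q h * x) * c h x := by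
  have hqa : q a ^ 2 = 1 := by rw [← map_pow, hG.sq_eq, map_one]
  have hqb : q b ^ 3 = 1 := by rw [← map_pow, hG.cube_eq, map_one]
  let A₀ : Q × FreeGroup D → Q × FreeGroup D := fun y => (q a * y.1, dartLabel D (q a) y.1 * y.2)
  have hA₀ : Function.Involutive A₀ := by
    rintro ⟨x, w⟩
    have h1 := dartLabel_mul_dartLabel D hqa hD x
    simp only [A₀, ← mul_assoc, h1, ← sq, hqa, one_mul]
  let A : Equiv.Perm (Q × FreeGroup D) := hA₀.toPerm A₀
  let B : Equiv.Perm (Q × FreeGroup D) := (Equiv.mulLeft (q b)).prodCongr (Equiv.refl _)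
  have hA : A ^ 2 = 1 := by
    ext1 y
    exact hA₀ y
  have hB : B ^ 3 = 1 := by
    ext1 y
    have h1 : q b * (q b * (q b * y.1)) = y.1 := by
      rw [← mul_assoc, ← mul_assoc, ← pow_three', hqb, one_mul]
    exact Prod.ext h1 rfl
  obtain ⟨θ, hθa, hθb⟩ := hG.exists_hom _ A B hA hB
  have hθ : ∀ g : G, ∀ x, ∃ u, ∀ w, θ g (x, w) = (q g * x, u * w) := by
    intro g
    have hg : g ∈ Subgroup.closure {a, b} := hG.closure_eq ▸ Subgroup.mem_top g
    induction hg using Subgroup.closure_induction with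
    | mem g hg =>
      rcases hg with rfl | rfl
      · exact fun x => ⟨_, fun w => by rw [hθa]; rfl⟩
      · exact fun x => ⟨1, fun w => by rw [hθb, one_mul]; rfl⟩
    | one => exact fun x => ⟨1, fun w => by simp⟩
    | mul g h _ _ hg hh =>
      intro x
      obtain ⟨u, hu⟩ := hh x
      obtain ⟨v, hv⟩ := hg (q h * x)
      exact ⟨v * u, fun w => by simp [hu, hv, mul_assoc]⟩
    | inv g _ hg =>
      intro x
      obtain ⟨u, hu⟩ := hg (q g⁻¹ * x)
      refine ⟨u⁻¹, fun w => ?_⟩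
      rw [map_inv, Equiv.Perm.inv_eq_iff_eq, hu]
      simp
  choose c hc using hθ
  refine ⟨c, fun x => ?_, fun x => ?_, fun g h x => ?_⟩
  · have h1 := hc a x 1
    rw [hθa] at h1
    simpa [A, A₀] using (congrArg Prod.snd h1).symm
  · have h1 := hc b x 1
    rw [hθb] at h1
    simpa [B] using (congrArg Prod.snd h1).symm
  · have h1 := hc (g * h) x 1
    rw [map_mul, Equiv.Perm.mul_apply, hc, hc] at h1
    simpa using (congrArg Prod.snd h1).symm

/-- The kernel of `q` is free on the darts in `D`, once lifts along a spanning tree `T` are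
given. -/
theorem IsModularPresentation.ker_mulEquiv_of_tree {a b : G} (hG : IsModularPresentation a b)
    (q : G →* Q) (D T : Set Q)
    (hD : ∀ x ∈ D, q a * x ∉ D) (hTD : ∀ x ∈ T, x ∉ D) (hT : ∀ x ∈ T, q a * x ∈ T)
    (hcov : ∀ x ∉ T, x ∈ D ∨ q a * x ∈ D)
    (hind : ∀ P : Q → Prop, P 1 → (∀ x, P x → P (q b * x)) → (∀ x ∈ T, P x → P (q a * x)) →
      ∀ x, P x)
    (g : Q → G) (hgq : ∀ x, q (g x) = x) (hg1 : g 1 = 1) (hgb : ∀ x, g (q b * x) = b * g x)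
    (hga : ∀ x ∈ T, g (q a * x) = a * g x) :
    Nonempty (q.ker ≃* FreeGroup D) := by
  obtain ⟨c, hca, hcb, hcmul⟩ := hG.exists_cocycle q D hD
  have haa : a * a = 1 := by rw [← sq, hG.sq_eq]
  have hqa : ∀ x, q a * (q a * x) = x := fun x => by
    rw [← mul_assoc, ← map_mul, haa, map_one, one_mul]
  have hlabT : ∀ x ∈ T, dartLabel D (q a) x = 1 := fun x hx => by
    simp [dartLabel, hTD x hx, hTD _ (hT x hx)]
  have hc1 : ∀ x, c 1 x = 1 := fun x => by simpa using hcmul 1 1 x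
  have hcinv : ∀ h x, c h⁻¹ x = (c h (q h⁻¹ * x))⁻¹ := fun h x => by
    have := hcmul h h⁻¹ x
    rw [mul_inv_cancel, hc1] at this
    exact eq_inv_of_mul_eq_one_right this.symm
  -- The Schreier generator of the dart `x`: out along the tree lift, across the edge by `a`, and
  -- back.
  let e : Q → q.ker := fun x => ⟨(g (q a * x))⁻¹ * a * g x, by simp [MonoidHom.mem_ker, hgq]⟩
  have heinv : ∀ x, e (q a * x) = (e x)⁻¹ := fun x => by
    have : a⁻¹ = a := inv_eq_of_mul_eq_one_right haa
    ext
    simp [e, hqa, mul_assoc, this]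
  have heT : ∀ x ∈ T, e x = 1 := fun x hx => by
    ext
    simp [e, hga x hx, mul_assoc]
  let s : FreeGroup D →* q.ker := FreeGroup.lift fun x => e x
  have hse : ∀ x, s (dartLabel D (q a) x) = e x := by
    intro x
    by_cases h : x ∈ D
    · simp [dartLabel, h, s]
    by_cases h' : q a * x ∈ D
    · simp [dartLabel, h, h', s, heinv]
    · have hx : x ∈ T := by
        by_contra hx
        rcases hcov x hx with h1 | h1
        exacts [h h1, h' h1]
      rw [hlabT x hx, heT x hx, map_one]
  -- Under `s` the cocycle becomes the coboundary of the lift `g`; at `x = 1` with `h` in the kernel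
  -- this says that `s` undoes `φ`.
  have hsc : ∀ h x, (s (c h x) : G) = (g (q h * x))⁻¹ * h * g x := by
    intro h
    have hh : h ∈ Subgroup.closure {a, b} := hG.closure_eq ▸ Subgroup.mem_top h
    induction hh using Subgroup.closure_induction with
    | mem h hh =>
      rcases hh with rfl | rfl
      · exact fun x => by rw [hca, hse]
      · exact fun x => by simp [hcb, hgb]
    | one => exact fun x => by simp [hc1]
    | mul h k _ _ ih ik => exact fun x => by simp [hcmul, ih, ik, mul_assoc]
    | inv h _ ih => exact fun x => by simp [hcinv, ih, mul_assoc]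
  let φ : q.ker →* FreeGroup D := MonoidHom.mk' (fun h => c h 1) fun h k => by
    have hk : q k = 1 := k.2
    simp [hcmul, hk]
  -- The lifts follow tree darts and powers of `b` only, so they collect no label; hence `φ` sends
  -- `e x` to the label of `x`.
  have hcg : ∀ x, c (g x) 1 = 1 := by
    refine hind _ ?_ ?_ ?_
    · rw [hg1, hc1]
    · intro x hx
      rw [hgb, hcmul, hx, hcb, one_mul]
    · intro x hxT hx
      rw [hga x hxT, hcmul, hx, hca, mul_one, hgq, mul_one, hlabT x hxT]
  refine ⟨φ.toMulEquiv s ?_ ?_⟩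
  · ext h
    have hh : q h = 1 := h.2
    simp [φ, hsc, hh, hg1]
  · ext1 x
    simp only [MonoidHom.comp_apply, MonoidHom.id_apply, s, FreeGroup.lift_apply_of]
    simp [φ, e, hcmul, hcinv, hgq, hcg, hca, dartLabel]

/-- An Euler characteristic count. That `q b ≠ 1` gives each vertex exactly three darts, and `q a ≠
1` makes dart reversal fixed-point-free. -/
theorem IsModularPresentation.exists_ker_mulEquiv [Finite Q] {a b : G}
    (hG : IsModularPresentation a b) (q : G →* Q) (hq : Function.Surjective q)
    (hqa : q a ≠ 1) (hqb : q b ≠ 1) :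
    ∃ M : ℕ, 6 * M = Nat.card Q + 6 ∧ Nonempty (q.ker ≃* FreeGroup (Fin M)) := by
  have haa : a * a = 1 := by rw [← sq, hG.sq_eq]
  have hqaa : ∀ x, q a * (q a * x) = x := fun x => by
    rw [← mul_assoc, ← map_mul, haa, map_one, one_mul]
  have hb3 : orderOf (q b) = 3 := by
    have : Fact (Nat.Prime 3) := ⟨Nat.prime_three⟩
    exact orderOf_eq_prime (by rw [← map_pow, hG.cube_eq, map_one]) hqb
  -- Exponents of `b` read off in `Q` are therefore unambiguous in `G`, which makes the lift `g`
  -- below compatible with `b`.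
  have hbpow : ∀ m n : ℕ, q b ^ m = q b ^ n → b ^ m = b ^ n := fun m n h => by
    rw [pow_eq_pow_iff_modEq] at h ⊢
    exact h.of_dvd (hb3 ▸ orderOf_dvd_of_pow_eq_one hG.cube_eq)
  let R := QuotientGroup.rightRel (Subgroup.zpowers (q b))
  let V := Quotient R
  let π : Q → V := Quotient.mk R
  have hπ : ∀ x y, π x = π y ↔ ∃ n : ℕ, y = q b ^ n * x := by
    intro x y
    rw [Quotient.eq, QuotientGroup.rightRel_apply, ← mem_powers_iff_mem_zpowers]
    constructor
    · rintro ⟨n, hn⟩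
      exact ⟨n, by rw [show q b ^ n = y * x⁻¹ from hn, inv_mul_cancel_right]⟩
    · rintro ⟨n, rfl⟩
      exact ⟨n, by simp⟩
  have hcardV : 3 * Nat.card V = Nat.card Q := by
    have h1 := Subgroup.card_eq_card_quotient_mul_card_subgroup (Subgroup.zpowers (q b))
    rw [Nat.card_zpowers, hb3] at h1
    rw [h1, mul_comm, Nat.card_congr (QuotientGroup.quotientRightRelEquivQuotientLeftRel _)]
  obtain ⟨t, d, ht1, hπt, hd⟩ := exists_parent_dart π (fun x => q a * x) 1 (by
      intro C h1 hC v
      obtain ⟨x, rfl⟩ := Quotient.mk_surjective v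
      obtain ⟨h, rfl⟩ := hq x
      have hh : h ∈ Subgroup.closure {a, b} := hG.closure_eq ▸ Subgroup.mem_top h
      suffices ∀ x, π (q h * x) ∈ C ↔ π x ∈ C by
        have h2 := (this 1).2 h1
        rwa [mul_one] at h2
      induction hh using Subgroup.closure_induction with
      | mem h hh =>
        rcases hh with rfl | rfl
        · exact fun x => ⟨hC x, fun hx => hC _ (by rwa [hqaa x])⟩
        · intro x
          rw [← (hπ x _).2 ⟨1, by rw [pow_one]⟩]
      | one => simp
      | mul h k _ _ ih ik => exact fun x => by rw [map_mul, mul_assoc, ih, ik]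
      | inv h _ ih => exact fun x => by rw [← ih, ← mul_assoc, ← map_mul]; simp)
  have htinj : Function.Injective t := Function.LeftInverse.injective hπt
  have hi : ∀ x, ∃ n : ℕ, x = q b ^ n * t (π x) := fun x => (hπ _ _).1 (hπt _)
  choose i hi using hi
  -- `γ v` lifts the parent dart `t v`: from the lift at the parent vertex, turn by a power of `b`
  -- to the reverse of `t v`, then cross by `a`.
  obtain ⟨γ, hγ1, hγ⟩ := exists_rec_of_parent d (π 1) (fun v => π (q a * t v)) hd (1 : G)
    (fun v y => a * (b ^ i (q a * t v) * y))
  have hqγ : ∀ n v, d v = n → q (γ v) = t v := by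
    intro n
    induction n using Nat.strong_induction_on with
    | _ n ih =>
      intro v hv
      by_cases hv1 : v = π 1
      · rw [hv1, hγ1, ht1, map_one]
      · rw [hγ v hv1, map_mul, map_mul, map_pow, ih _ (hv ▸ hd v hv1) _ rfl, ← hi]
        exact hqaa _
  -- The parent darts of the non-root vertices; `T` adds their reversals, and `D` orients the
  -- remaining edges.
  let N : Set Q := t '' {v | v ≠ π 1}
  let T : Set Q := N ∪ (fun x => q a * x) '' N
  have hT : ∀ x ∈ T, q a * x ∈ T := by
    rintro x (h | ⟨y, h, rfl⟩)
    · exact Or.inr ⟨x, h, rfl⟩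
    · exact Or.inl (by simpa only [hqaa y] using h)
  obtain ⟨D, hDT, hD, hcov⟩ := Function.Involutive.exists_transversal hqaa (by simpa using hqa) Tᶜ
    (fun x hx hx' => hx (by simpa only [hqaa x] using hT _ hx'))
  let g : Q → G := fun x => b ^ i x * γ (π x)
  have hgt : ∀ v, g (t v) = γ v := by
    intro v
    have h1 := hi (t v)
    rw [hπt] at h1
    have h2 := hbpow _ 0 ((right_eq_mul.1 h1).trans (pow_zero _).symm)
    simp only [g]
    rw [h2, hπt, pow_zero, one_mul]
  have hgN : ∀ v, v ≠ π 1 → g (t v) = a * g (q a * t v) := fun v hv => by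
    rw [hgt, hγ v hv]
  have hequiv : Nonempty (q.ker ≃* FreeGroup D) := by
    refine hG.ker_mulEquiv_of_tree q D T hD (fun x hx hx' => hDT hx' hx) hT hcov ?_ g ?_ ?_ ?_ ?_
    · intro P h1 hb ha
      have hbn : ∀ (n : ℕ) x, P x → P (q b ^ n * x) := by
        intro n x hx
        induction n with
        | zero => simpa using hx
        | succ n ih => rw [pow_succ', mul_assoc]; exact hb _ ih
      have hPt : ∀ n v, d v = n → P (t v) := by
        intro n
        induction n using Nat.strong_induction_on with
        | _ n ih =>
          intro v hv
          by_cases hv1 : v = π 1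
          · rwa [hv1, ht1]
          · have h2 := hbn (i (q a * t v)) _ (ih _ (hv ▸ hd v hv1) _ rfl)
            rw [← hi] at h2
            have h3 := ha _ (Or.inr ⟨t v, ⟨v, hv1, rfl⟩, rfl⟩) h2
            rwa [hqaa (t v)] at h3
      intro x
      rw [hi x]
      exact hbn _ _ (hPt _ _ rfl)
    · intro x
      simp only [g]
      rw [map_mul, map_pow, hqγ _ _ rfl, ← hi]
    · rw [← ht1, hgt, hγ1]
    · intro x
      have h1 : π x = π (q b * x) := (hπ _ _).2 ⟨1, by rw [pow_one]⟩
      have h2 : q b ^ i (q b * x) = q b ^ (i x + 1) := by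
        have h3 := hi (q b * x)
        rw [← h1] at h3
        nth_rw 1 [hi x] at h3
        rw [← mul_assoc, ← pow_succ'] at h3
        exact (mul_right_cancel h3).symm
      simp only [g]
      rw [hbpow _ _ h2, ← h1, pow_succ', mul_assoc]
    · rintro x (⟨v, hv, rfl⟩ | ⟨y, ⟨v, hv, rfl⟩, rfl⟩)
      · rw [hgN v hv, ← mul_assoc, haa, one_mul]
      · rw [← hgN v hv, hqaa (t v)]
  have hcount : Nat.card Q = 2 * N.ncard + 2 * D.ncard := by
    have himg : ∀ S : Set Q, ((fun x => q a * x) '' S).ncard = S.ncard :=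
      fun S => Set.ncard_image_of_injective S (Function.Involutive.injective hqaa)
    -- A dart and its reversal cannot both be parent darts: depth would strictly decrease in both
    -- directions.
    have hNN : Disjoint N ((fun x => q a * x) '' N) := by
      rw [Set.disjoint_left]
      rintro _ ⟨v, hv, rfl⟩ ⟨_, ⟨w, hw, rfl⟩, hvw⟩
      simp only at hvw
      have h1 := hd w hw
      have h2 := hd v hv
      rw [hvw, hπt] at h1
      rw [← hvw, hqaa (t w), hπt] at h2
      exact lt_asymm h1 h2
    have hDD : Disjoint D ((fun x => q a * x) '' D) := by
      rw [Set.disjoint_left]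
      rintro _ hx ⟨y, hy, rfl⟩
      exact hD y hy hx
    have hTD : Disjoint T (D ∪ (fun x => q a * x) '' D) := by
      rw [Set.disjoint_left]
      rintro x hx (h | ⟨y, hy, rfl⟩)
      · exact hDT h hx
      · exact hDT hy (by simpa only [hqaa y] using hT _ hx)
    have huniv : T ∪ (D ∪ (fun x => q a * x) '' D) = Set.univ := by
      refine Set.eq_univ_of_forall fun x => ?_
      by_cases hx : x ∈ T
      · exact Or.inl hx
      · rcases hcov x hx with h | h
        · exact Or.inr (Or.inl h)
        · exact Or.inr (Or.inr ⟨_, h, hqaa x⟩)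
    rw [← Set.ncard_univ, ← huniv, Set.ncard_union_eq hTD, Set.ncard_union_eq hNN,
      Set.ncard_union_eq hDD, himg, himg]
    ring
  have hN : N.ncard + 1 = Nat.card V := by
    have : {v | v ≠ π 1} = Set.univ \ {π 1} := by ext; simp
    rw [Set.ncard_image_of_injective _ htinj, this,
      Set.ncard_sdiff_singleton_add_one (Set.mem_univ _), Set.ncard_univ]
  refine ⟨D.ncard, by omega, ?_⟩
  obtain ⟨e⟩ := hequiv
  have : Nat.card D = D.ncard := Nat.card_coe_set_eq D
  exact ⟨e.trans (FreeGroup.freeGroupCongr (this ▸ Finite.equivFin D))⟩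

end ModularFree

/-! ### The order of SL₂(𝔽_p). -/

section SpecialLinear

/-- SL₂ is the kernel of the surjective determinant on GL₂, whose order is known; divide by p - 1.
-/
theorem Matrix.SpecialLinearGroup.card_fin_two (p : ℕ) [Fact p.Prime] :
    Nat.card SL(2, ZMod p) = (p - 1) * p * (p + 1) := by
  let e : SL(2, ZMod p) ≃ (Matrix.GeneralLinearGroup.det (n := Fin 2) (R := ZMod p)).ker :=
    { toFun := fun A => ⟨(A : GL (Fin 2) (ZMod p)), by
        rw [MonoidHom.mem_ker]; ext; simp⟩
      invFun := fun A => ⟨(A : GL (Fin 2) (ZMod p)), by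
        have h := congrArg Units.val (MonoidHom.mem_ker.1 A.2)
        simpa using h⟩
      left_inv := fun A => by ext; simp
      right_inv := fun A => by ext; rfl }
  have hsurj : Function.Surjective (Matrix.GeneralLinearGroup.det (n := Fin 2) (R := ZMod p)) := by
    intro u
    refine ⟨Matrix.GeneralLinearGroup.mkOfDetNeZero !![(u : ZMod p), 0; 0, 1] (by simp), ?_⟩
    ext
    simp [Matrix.GeneralLinearGroup.mkOfDetNeZero]
  have h1 := (Matrix.GeneralLinearGroup.det (n := Fin 2) (R := ZMod p)).ker.card_mul_index
  rw [Subgroup.index_ker, MonoidHom.range_eq_top.2 hsurj, Subgroup.card_top,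
    ← Nat.card_congr e, Matrix.card_GL_field, Nat.card_eq_fintype_card (α := (ZMod p)ˣ),
    ZMod.card_units] at h1
  have hp := (Fact.out : p.Prime).two_le
  obtain ⟨k, rfl⟩ : ∃ k, p = k + 1 := ⟨p - 1, by omega⟩
  simp only [Fin.prod_univ_two, ZMod.card, Nat.add_sub_cancel] at h1 ⊢
  have h2 : (k + 1) ^ 2 - (k + 1) ^ 0 = k * (k + 2) := by
    rw [show (k + 1) ^ 2 = k * (k + 2) + 1 by ring]; simp
  have h3 : (k + 1) ^ 2 - (k + 1) ^ 1 = k * (k + 1) := by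
    rw [show (k + 1) ^ 2 = k * (k + 1) + (k + 1) ^ 1 by ring]; simp
  simp only [Fin.val_zero, Fin.val_one, h2, h3] at h1
  refine Nat.eq_of_mul_eq_mul_right (show 0 < k by omega) (h1.trans (by ring))

end SpecialLinear

/-! ### The full twist, and surjectivity of ρ_p. -/

namespace BraidGroup

theorem sigma1_mul_sigma2_mul_sigma1 : sigma1 * sigma2 * sigma1 = sigma2 * sigma1 * sigma2 := by
  have h := PresentedGroup.one_of_mem (rels := {r | BraidRelator 3 r})
    (BraidRelator.braid (0 : Fin 2) (1 : Fin 2) (Or.inl rfl))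
  rw [map_mul, map_inv, mul_inv_eq_one] at h
  exact h

/-- The full twist `Δ ^ 2 = (σ₁ σ₂) ^ 3`. -/
def fullTwist : BraidGroup 3 := (sigma1 * sigma2) ^ 3

/-- The half twist `Δ = σ₁ σ₂ σ₁`. -/
def halfTwist : BraidGroup 3 := sigma1 * sigma2 * sigma1

theorem halfTwist_sq : halfTwist ^ 2 = fullTwist := by
  have h := sigma1_mul_sigma2_mul_sigma1
  calc halfTwist ^ 2 = sigma1 * sigma2 * sigma1 * (sigma1 * sigma2 * sigma1) := sq _
    _ = sigma1 * sigma2 * sigma1 * (sigma2 * sigma1 * sigma2) := by rw [h]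
    _ = fullTwist := by simp only [fullTwist, pow_succ, pow_zero, one_mul, mul_assoc]

theorem sigma1_eq : sigma1 = (sigma1 * sigma2)⁻¹ * halfTwist := by
  rw [halfTwist, inv_mul_cancel_left]

theorem sigma2_eq : sigma2 = halfTwist⁻¹ * (sigma1 * sigma2) ^ 2 := by
  rw [halfTwist, sigma1_mul_sigma2_mul_sigma1, sq]
  nth_rw 2 [← mul_assoc]
  rw [sigma1_mul_sigma2_mul_sigma1]
  group

theorem closure_halfTwist : Subgroup.closure {halfTwist, sigma1 * sigma2} = ⊤ := by
  rw [eq_top_iff]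
  rintro g -
  have ha : halfTwist ∈ Subgroup.closure {halfTwist, sigma1 * sigma2} :=
    Subgroup.subset_closure (by simp)
  have hb : sigma1 * sigma2 ∈ Subgroup.closure {halfTwist, sigma1 * sigma2} :=
    Subgroup.subset_closure (by simp)
  induction g using induction3 with
  | h1 =>
    have h := mul_mem (inv_mem hb) ha
    rwa [← sigma1_eq] at h
  | h2 =>
    have h := mul_mem (inv_mem ha) (pow_mem hb 2)
    rwa [← sigma2_eq] at h
  | hone => exact one_mem _
  | hmul x y hx hy => exact mul_mem hx hy
  | hinv x hx => exact inv_mem hx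

theorem commute_fullTwist (g : BraidGroup 3) : Commute fullTwist g := by
  have hg : g ∈ Subgroup.closure {halfTwist, sigma1 * sigma2} :=
    closure_halfTwist ▸ Subgroup.mem_top g
  induction hg using Subgroup.closure_induction with
  | mem x hx =>
    rcases hx with rfl | rfl
    · rw [← halfTwist_sq]; exact Commute.pow_self _ _
    · exact Commute.pow_self _ _
  | one => exact Commute.one_right _
  | mul x y _ _ hx hy => exact hx.mul_right hy
  | inv x _ hx => exact hx.inv_right

instance normal_zpowers_fullTwist : (Subgroup.zpowers fullTwist).Normal where
  conj_mem := by
    rintro _ ⟨n, rfl⟩ g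
    refine ⟨n, ?_⟩
    simp only
    rw [← ((commute_fullTwist g).zpow_left n).eq, mul_inv_cancel_right]

theorem isModularPresentation_quotient_fullTwist :
    IsModularPresentation (halfTwist : BraidGroup 3 ⧸ Subgroup.zpowers fullTwist)
      ((sigma1 * sigma2 : BraidGroup 3) : BraidGroup 3 ⧸ Subgroup.zpowers fullTwist) where
  sq_eq := by
    rw [← QuotientGroup.mk_pow, halfTwist_sq, QuotientGroup.eq_one_iff]
    exact Subgroup.mem_zpowers _
  cube_eq := by
    rw [← QuotientGroup.mk_pow, QuotientGroup.eq_one_iff]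
    exact Subgroup.mem_zpowers _
  closure_eq := by
    have h := MonoidHom.map_closure (QuotientGroup.mk' (Subgroup.zpowers fullTwist))
      {halfTwist, sigma1 * sigma2}
    rw [closure_halfTwist, ← MonoidHom.range_eq_map, QuotientGroup.range_mk',
      Set.image_pair] at h
    exact h.symm
  exists_hom := by
    intro P _ A B hA hB
    -- The images of σ₁ and σ₂ are forced by σ₁ = b⁻¹a and σ₂ = a⁻¹b². The two sides of the braid
    -- relation become `A` and `A⁻¹ * B ^ 3`, equal by the hypotheses.
    have h1 : B⁻¹ * A * (A⁻¹ * B ^ 2) = B := by group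
    have h2 : B⁻¹ * A * (A⁻¹ * B ^ 2) * (B⁻¹ * A) = A := by group
    let f := lift3 (B⁻¹ * A) (A⁻¹ * B ^ 2) (by
      rw [h2, mul_assoc (A⁻¹ * B ^ 2), h1, mul_assoc, ← pow_succ, hB, mul_one]
      exact (inv_eq_of_mul_eq_one_left (by rw [← sq, hA])).symm)
    have hfb : f (sigma1 * sigma2) = B := by
      rw [map_mul, lift3_sigma1, lift3_sigma2, h1]
    have hfa : f halfTwist = A := by
      rw [halfTwist, map_mul, hfb, lift3_sigma1, mul_inv_cancel_left]
    have hf : ∀ x ∈ Subgroup.zpowers fullTwist, f x = 1 := by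
      rintro _ ⟨n, rfl⟩
      simp only
      rw [map_zpow, fullTwist, map_pow, hfb, hB, one_zpow]
    exact ⟨QuotientGroup.lift _ f hf, hfa, hfb⟩

/-- The exponent sum B₃ → ℤ takes the value 6 on Δ². -/
theorem fullTwist_zpow_injective : Function.Injective fun n : ℤ => fullTwist ^ n := by
  let f : BraidGroup 3 →* Multiplicative ℤ :=
    lift3 (Multiplicative.ofAdd 1) (Multiplicative.ofAdd 1) rfl
  have hf : ∀ n : ℤ, f (fullTwist ^ n) = Multiplicative.ofAdd (6 * n) := by
    intro n
    rw [map_zpow, fullTwist, map_pow, map_mul, lift3_sigma1, lift3_sigma2, ← ofAdd_add,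
      ← ofAdd_nsmul, ← ofAdd_zsmul]
    congr 1
    simp
    ring
  intro m n h
  have h1 := congrArg f h
  simp only [hf] at h1
  have h2 := Multiplicative.ofAdd.injective h1
  omega

theorem rho_fullTwist : rho fullTwist = -1 := by
  rw [fullTwist, map_pow, map_mul, rho, lift3_sigma1, lift3_sigma2]
  decide

theorem rhoMod_fullTwist (m : ℕ) : rhoMod m fullTwist = -1 := by
  rw [rhoMod, MonoidHom.comp_apply, rho_fullTwist]
  ext i j
  simp

theorem rhoMod_sigma1 (m : ℕ) : (rhoMod m sigma1 : Matrix (Fin 2) (Fin 2) (ZMod m)) =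
    !![1, -1; 0, 1] := by
  rw [rhoMod, MonoidHom.comp_apply, rho, lift3_sigma1, Matrix.SpecialLinearGroup.map_apply_coe]
  ext i j
  fin_cases i <;> fin_cases j <;> simp [rhoSigma1]

theorem rhoMod_sigma2 (m : ℕ) : (rhoMod m sigma2 : Matrix (Fin 2) (Fin 2) (ZMod m)) =
    !![1, 0; 1, 1] := by
  rw [rhoMod, MonoidHom.comp_apply, rho, lift3_sigma2, Matrix.SpecialLinearGroup.map_apply_coe]
  ext i j
  fin_cases i <;> fin_cases j <;> simp [rhoSigma2]

theorem rhoMod_sigma1_pow (m n : ℕ) :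
    (rhoMod m ((sigma1⁻¹) ^ n) : Matrix (Fin 2) (Fin 2) (ZMod m)) = !![1, (n : ZMod m); 0, 1] := by
  induction n with
  | zero => ext i j; fin_cases i <;> fin_cases j <;> simp
  | succ n ih =>
    rw [pow_succ, map_mul, Matrix.SpecialLinearGroup.coe_mul, ih, map_inv,
      Matrix.SpecialLinearGroup.coe_inv, rhoMod_sigma1]
    ext i j
    fin_cases i <;> fin_cases j <;> simp [add_comm]

theorem rhoMod_sigma2_pow (m n : ℕ) :
    (rhoMod m (sigma2 ^ n) : Matrix (Fin 2) (Fin 2) (ZMod m)) = !![1, 0; (n : ZMod m), 1] := by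
  induction n with
  | zero => ext i j; fin_cases i <;> fin_cases j <;> simp
  | succ n ih =>
    rw [pow_succ, map_mul, Matrix.SpecialLinearGroup.coe_mul, ih, rhoMod_sigma2]
    ext i j
    fin_cases i <;> fin_cases j <;> simp

theorem rhoMod_surjective (p : ℕ) [Fact p.Prime] : Function.Surjective (rhoMod p) := by
  have key : ∀ A : SL(2, ZMod p), A 1 0 ≠ 0 → A ∈ (rhoMod p).range := by
    intro A hA
    have hdet := A.det_coe
    rw [Matrix.det_fin_two] at hdet
    -- An upper, lower, upper unipotent product: the exponents match the diagonal and the lower-left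
    -- entry, and the determinant fixes the last one.
    refine ⟨sigma1⁻¹ ^ ((A 0 0 - 1) / A 1 0).val * sigma2 ^ (A 1 0).val *
      sigma1⁻¹ ^ ((A 1 1 - 1) / A 1 0).val, ?_⟩
    apply Subtype.ext
    rw [map_mul, map_mul, Matrix.SpecialLinearGroup.coe_mul, Matrix.SpecialLinearGroup.coe_mul,
      rhoMod_sigma1_pow, rhoMod_sigma2_pow, rhoMod_sigma1_pow]
    simp only [ZMod.natCast_val, ZMod.cast_id', id_eq]
    ext i j
    fin_cases i <;> fin_cases j <;> simp
    all_goals field_simp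
    · ring
    · linear_combination hdet
    · ring
  intro A
  by_cases hA : A 1 0 = 0
  · have hA0 : A 0 0 ≠ 0 := by
      intro h
      have hdet := A.det_coe
      rw [Matrix.det_fin_two, hA, h] at hdet
      simp at hdet
    -- Adding the first row to the second makes the lower-left entry `A 0 0`, which is nonzero.
    have h1 : rhoMod p sigma2 * A ∈ (rhoMod p).range := by
      apply key
      rw [Matrix.SpecialLinearGroup.coe_mul, rhoMod_sigma2]
      simpa [Matrix.mul_apply, hA] using hA0
    rwa [Subgroup.mul_mem_cancel_left _ (MonoidHom.mem_range.2 ⟨sigma2, rfl⟩)] at h1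
  · exact key A hA

end BraidGroup

/-! ### Splitting the central extension. -/

/-- A central extension of a free group by an infinite cyclic group is a product. -/
theorem MonoidHom.exists_mulEquiv_prod_freeGroup {K α : Type*} [Group K] (φ : K →* FreeGroup α)
    (hφ : Function.Surjective φ) (c : K) (hc : ∀ x, Commute c x)
    (hker : ∀ x, φ x = 1 ↔ ∃ n : ℤ, c ^ n = x) (hinj : Function.Injective fun n : ℤ => c ^ n) :
    ∃ e : K ≃* Multiplicative ℤ × FreeGroup α, e.symm (Multiplicative.ofAdd 1, 1) = c := by
  choose r hr using hφ
  -- Freeness gives a section of `φ`; it commutes with the central `c`, so the two combine into a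
  -- map from the product.
  let s : FreeGroup α →* K := FreeGroup.lift fun x => r (FreeGroup.of x)
  have hs : ∀ w, φ (s w) = w := fun w => by
    have : φ.comp s = MonoidHom.id _ := by ext x; simp [s, hr]
    exact DFunLike.congr_fun this w
  have hφc : ∀ n : ℤ, φ (c ^ n) = 1 := fun n => (hker _).2 ⟨n, rfl⟩
  let ψ : Multiplicative ℤ × FreeGroup α →* K :=
    MonoidHom.noncommCoprod (zpowersHom K c) s fun n w => (hc (s w)).zpow_left _
  have hψ : ∀ n w, ψ (n, w) = c ^ n.toAdd * s w := fun n w => rfl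
  have hbij : Function.Bijective ψ := by
    constructor
    · rw [injective_iff_map_eq_one]
      rintro ⟨n, w⟩ h
      rw [hψ] at h
      have hw : w = 1 := by simpa [hφc, hs] using congrArg φ h
      rw [hw, map_one, mul_one, ← zpow_zero c] at h
      exact Prod.ext (hinj h) hw
    · intro x
      obtain ⟨n, hn⟩ := (hker (x * (s (φ x))⁻¹)).1 (by simp [hs])
      exact ⟨(Multiplicative.ofAdd n, φ x), by simp [hψ, hn]⟩
  refine ⟨(MulEquiv.ofBijective ψ hbij).symm, ?_⟩
  rw [MulEquiv.symm_symm, MulEquiv.ofBijective_apply, hψ]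
  simp

/-! ### Passing to SL₂/{±1} and back to B₃[p]. -/

namespace BraidGroup

theorem rhoMod_halfTwist (m : ℕ) :
    (rhoMod m halfTwist : Matrix (Fin 2) (Fin 2) (ZMod m)) = !![0, -1; 1, 0] := by
  rw [halfTwist, map_mul, map_mul, Matrix.SpecialLinearGroup.coe_mul,
    Matrix.SpecialLinearGroup.coe_mul, rhoMod_sigma1, rhoMod_sigma2]
  simp

theorem rhoMod_sigma1_mul_sigma2 (m : ℕ) :
    (rhoMod m (sigma1 * sigma2) : Matrix (Fin 2) (Fin 2) (ZMod m)) = !![0, -1; 1, 1] := by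
  rw [map_mul, Matrix.SpecialLinearGroup.coe_mul, rhoMod_sigma1, rhoMod_sigma2]
  simp

theorem mem_zpowers_neg_one_iff {R : Type*} [CommRing R] (A : SL(2, R)) :
    A ∈ Subgroup.zpowers (-1 : SL(2, R)) ↔ A = 1 ∨ A = -1 := by
  constructor
  · rintro ⟨n, rfl⟩
    rcases Int.even_or_odd n with h | h
    · exact Or.inl h.neg_one_zpow
    · exact Or.inr h.neg_one_zpow
  · rintro (rfl | rfl)
    · exact one_mem _
    · exact Subgroup.mem_zpowers _

instance normal_zpowers_neg_one {R : Type*} [CommRing R] :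
    (Subgroup.zpowers (-1 : SL(2, R))).Normal where
  conj_mem := by
    intro A hA B
    rw [mem_zpowers_neg_one_iff] at hA ⊢
    rcases hA with rfl | rfl <;> simp

/-- The homomorphism `B_3 / ⟨Δ²⟩ → SL_2(ℤ/m) / {±1}` induced by `ρ_m`. -/
noncomputable def projectiveRhoMod (m : ℕ) : BraidGroup 3 ⧸ Subgroup.zpowers fullTwist →*
    SL(2, ZMod m) ⧸ Subgroup.zpowers (-1 : SL(2, ZMod m)) :=
  QuotientGroup.map _ _ (rhoMod m) (by
    rw [Subgroup.zpowers_le, Subgroup.mem_comap, rhoMod_fullTwist]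
    exact Subgroup.mem_zpowers _)

theorem projectiveRhoMod_mk_eq_one_iff (m : ℕ) (g : BraidGroup 3) :
    projectiveRhoMod m g = 1 ↔ rhoMod m g = 1 ∨ rhoMod m g = -1 := by
  rw [← mem_zpowers_neg_one_iff, ← QuotientGroup.eq_one_iff]
  rfl

theorem SL_neg_one_ne_one {p : ℕ} [Fact p.Prime] (hp3 : 3 ≤ p) : (-1 : SL(2, ZMod p)) ≠ 1 := by
  have : Fact (2 < p) := ⟨hp3⟩
  intro h
  have h1 := congrArg (fun A : SL(2, ZMod p) => A 0 0) h
  simp [ZMod.neg_one_ne_one] at h1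

theorem exists_ker_projectiveRhoMod_mulEquiv {p : ℕ} [Fact p.Prime] (hp3 : 3 ≤ p) :
    ∃ M : ℕ, 12 * M = (p - 1) * p * (p + 1) + 12 ∧
      Nonempty ((projectiveRhoMod p).ker ≃* FreeGroup (Fin M)) := by
  have hsurj : Function.Surjective (projectiveRhoMod p) :=
    QuotientGroup.map_surjective_of_surjective _ _ _
      ((QuotientGroup.mk'_surjective _).comp (rhoMod_surjective p)) _
  have ha : projectiveRhoMod p (halfTwist : BraidGroup 3) ≠ 1 := by
    rw [Ne, projectiveRhoMod_mk_eq_one_iff]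
    rintro (h | h) <;>
    · have h1 := congrArg (fun A : SL(2, ZMod p) => A 1 0) h
      simp [rhoMod_halfTwist] at h1
  have hb : projectiveRhoMod p (sigma1 * sigma2 : BraidGroup 3) ≠ 1 := by
    rw [Ne, projectiveRhoMod_mk_eq_one_iff]
    rintro (h | h) <;>
    · have h1 := congrArg (fun A : SL(2, ZMod p) => A 1 0) h
      simp only [rhoMod_sigma1_mul_sigma2] at h1
      simp at h1
  obtain ⟨M, hM, hiso⟩ := isModularPresentation_quotient_fullTwist.exists_ker_mulEquiv
    (projectiveRhoMod p) hsurj ha hb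
  refine ⟨M, ?_, hiso⟩
  have h2 := Subgroup.card_eq_card_quotient_mul_card_subgroup
    (Subgroup.zpowers (-1 : SL(2, ZMod p)))
  rw [Nat.card_zpowers, orderOf_eq_prime (p := 2) (by simp) (SL_neg_one_ne_one hp3),
    Matrix.SpecialLinearGroup.card_fin_two] at h2
  omega

theorem exists_congruenceSubgroup_mulEquiv {p : ℕ} [Fact p.Prime] (hp3 : 3 ≤ p) {α : Type*}
    (ε : (projectiveRhoMod p).ker ≃* FreeGroup α) :
    ∃ e : congruenceSubgroup p ≃* Multiplicative ℤ × FreeGroup α,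
      ((e.symm (Multiplicative.ofAdd (1 : ℤ), 1) : congruenceSubgroup p) : BraidGroup 3) =
        (sigma1 * sigma2) ^ 6 := by
  have hmem : ∀ g : BraidGroup 3, g ∈ congruenceSubgroup p ↔ rhoMod p g = 1 :=
    fun g => MonoidHom.mem_ker
  let π : congruenceSubgroup p →* (projectiveRhoMod p).ker :=
    ((QuotientGroup.mk' (Subgroup.zpowers fullTwist)).comp (congruenceSubgroup p).subtype).codRestrict
      _ fun g => (projectiveRhoMod_mk_eq_one_iff p g).2 (Or.inl ((hmem g).1 g.2))
  have hπ : Function.Surjective π := by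
    rintro ⟨x, hx⟩
    obtain ⟨g, rfl⟩ := QuotientGroup.mk_surjective x
    rcases (projectiveRhoMod_mk_eq_one_iff p g).1 hx with h | h
    · exact ⟨⟨g, (hmem g).2 h⟩, rfl⟩
    -- If ρ_p(g) = -1, multiplying by Δ² corrects the sign without changing the class modulo ⟨Δ²⟩.
    · refine ⟨⟨g * fullTwist, (hmem _).2 (by simp [h, rhoMod_fullTwist])⟩, Subtype.ext ?_⟩
      exact QuotientGroup.mk_mul_of_mem g (Subgroup.mem_zpowers fullTwist)
  have hc : (sigma1 * sigma2 : BraidGroup 3) ^ 6 = fullTwist ^ 2 := by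
    rw [fullTwist, ← pow_mul]
  let c : congruenceSubgroup p := ⟨(sigma1 * sigma2) ^ 6, by
    rw [hmem, hc, map_pow, rhoMod_fullTwist]; simp⟩
  have hczpow : ∀ n : ℤ, ((c ^ n : congruenceSubgroup p) : BraidGroup 3) = fullTwist ^ (2 * n) := by
    intro n
    rw [Subgroup.coe_zpow, zpow_mul]
    simp only [c, hc]
    norm_cast
  obtain ⟨e, he⟩ := MonoidHom.exists_mulEquiv_prod_freeGroup (ε.toMonoidHom.comp π)
    (ε.surjective.comp hπ) c
    (fun x => Subtype.ext (by
      simp only [Subgroup.coe_mul, c, hc]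
      exact ((commute_fullTwist x).pow_left 2).eq))
    (fun x => by
      rw [MonoidHom.comp_apply, MulEquiv.toMonoidHom_eq_coe, MonoidHom.coe_coe,
        MulEquiv.map_eq_one_iff]
      have h1 : π x = 1 ↔ (x : BraidGroup 3) ∈ Subgroup.zpowers fullTwist := by
        rw [Subtype.ext_iff]
        exact QuotientGroup.eq_one_iff _
      rw [h1]
      constructor
      · rintro ⟨n, hn⟩
        simp only at hn
        have hx := (hmem x).1 x.2
        rw [← hn, map_zpow, rhoMod_fullTwist] at hx
        -- Only even powers of Δ² lie in B₃[p], since odd ones map to -1 ≠ 1; this is why the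
        -- generator is (σ₁σ₂)⁶ and not (σ₁σ₂)³.
        rcases Int.even_or_odd n with h | h
        · obtain ⟨k, rfl⟩ := h
          exact ⟨k, Subtype.ext (by rw [hczpow, ← hn, two_mul])⟩
        · rw [h.neg_one_zpow] at hx
          exact absurd hx (SL_neg_one_ne_one hp3)
      · rintro ⟨n, rfl⟩
        exact ⟨2 * n, (hczpow n).symm⟩)
    (fun m n h => by
      have h1 := congrArg (Subtype.val) h
      simp only [hczpow] at h1
      have := fullTwist_zpow_injective h1
      omega)
  exact ⟨e, by rw [he]⟩

end BraidGroup

theorem mainTheorem4 (p : ℕ) (hp : p.Prime) (hp3 : 3 ≤ p) :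
    ∃ M : ℕ, (M : ℚ) = 1 + ((p : ℚ) - 1) * (p : ℚ) * ((p : ℚ) + 1) / 12 ∧
      ∃ e : BraidGroup.congruenceSubgroup p ≃* Multiplicative ℤ × FreeGroup (Fin M),
        ((e.symm (Multiplicative.ofAdd (1 : ℤ), 1) : BraidGroup.congruenceSubgroup p) :
            BraidGroup 3) =
          (BraidGroup.sigma1 * BraidGroup.sigma2) ^ 6 := by
  have : Fact p.Prime := ⟨hp⟩
  obtain ⟨M, hM, ⟨ε⟩⟩ := BraidGroup.exists_ker_projectiveRhoMod_mulEquiv hp3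
  refine ⟨M, ?_, BraidGroup.exists_congruenceSubgroup_mulEquiv hp3 ε⟩
  have h1 := congrArg (Nat.cast : ℕ → ℚ) hM
  push_cast [Nat.cast_sub hp.one_le] at h1
  linarith
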